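/- Let $p$ be an odd prime and let $G$ be a profinite group. Write $H^i(G)=H^i(G,\mathbb{Z}/p)$ for the profinite cohomology groups with trivial action of $G$ on $\mathbb{Z}/p$, so that $H^1(G)$ is the group of continuous homomorphisms $G\to\mathbb{Z}/p$. Let $\cup\colon H^1(G)\otimes_{\mathbb{Z}}H^1(G)\to H^2(G)$ be the homomorphism induced by the cup product, and let $\beta_G\colon H^1(G)\to H^2(G)$ be the Bockstein homomorphism, i.e. the connecting homomorphism of the exact sequence $0\to\mathbb{Z}/p\to\mathbb{Z}/p^2\to\mathbb{Z}/p\to0$ of trivial $G$-modules. Let $G^{(1)}=G$ and, for $i\ge1$, let $G^{(i+1)}=(G^{(i)})^p[G^{(i)},G]$ be the closed subgroup of $G$ generated by all powers $h^p$ and all commutators $h^{-1}g^{-1}hg$ with $h\in G^{(i)}$ and $g\in G$. Suppose that $G$ has Galois relation type (with respect to $q=p$), that is: (i) the kernel of $\cup\colon H^1(G)\otimes_{\mathbb{Z}}H^1(G)\to H^2(G)$ is generated, as a group, by elements of the form $\psi\otimes\psi'$ with $\psi,\psi'\in H^1(G)$; and (ii) there exists $\xi\in H^1(G)$ such that $\psi\cup\xi+\beta_G(\psi)=0$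 for every $\psi\in H^1(G)$. (For a prime power $q=p^d$ in place of $p$, one requires in addition that the natural map $H^1(G,\mathbb{Z}/q)\to H^1(G,\mathbb{Z}/p^i)$ be surjective for $1\le i\le d$; for $q=p$ this holds trivially.) Then every element of order $p$ in the quotient group $G/G^{(3)}$ lies in $G^{(2)}/G^{(3)}$. -/

import Mathlib

open scoped TensorProduct

namespace GaloisRelation

section Cohomology

variable (G : Type*) [Group G] [TopologicalSpace G] [IsTopologicalGroup G] (q : ℕ)

/-- `H¹(G, ℤ/q)` for the trivial action: the group of continuous homomorphisms from `G` to the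
discrete group `ℤ/q`. -/
abbrev H1 : Type _ := Additive G →ₜ+ ZMod q

/-- The differential from continuous inhomogeneous 1-cochains to 2-cochains with values in the
trivial discrete module `ℤ/q`: `(d b)(σ, τ) = b(τ) - b(στ) + b(σ)`. -/
def d1 : C(G, ZMod q) →+ C(G × G, ZMod q) where
  toFun b := ⟨fun x => b x.2 - b (x.1 * x.2) + b x.1, by fun_prop⟩
  map_zero' := by ext; simp
  map_add' b b' := by ext x; simp; ring

/-- The differential from continuous inhomogeneous 2-cochains to 3-cochains:
`(d f)(σ, τ, ρ) = f(τ, ρ) - f(στ, ρ) + f(σ, τρ) - f(σ, τ)`. -/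
def d2 : C(G × G, ZMod q) →+ C(G × G × G, ZMod q) where
  toFun f := ⟨fun x => f (x.2.1, x.2.2) - f (x.1 * x.2.1, x.2.2) + f (x.1, x.2.1 * x.2.2)
    - f (x.1, x.2.1), by fun_prop⟩
  map_zero' := by ext; simp
  map_add' f f' := by ext x; simp; ring

/-- Continuous 2-cocycles. -/
abbrev Z2 : AddSubgroup C(G × G, ZMod q) := (d2 G q).ker

/-- Continuous 2-coboundaries. -/
abbrev B2 : AddSubgroup C(G × G, ZMod q) := (d1 G q).range

theorem B2_le_Z2 : B2 G q ≤ Z2 G q := by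
  rintro _ ⟨b, rfl⟩
  rw [AddMonoidHom.mem_ker]
  ext x
  simp [d1, d2, mul_assoc]
  ring

/-- `H²(G, ℤ/q)`: continuous 2-cocycles modulo continuous 2-coboundaries. -/
abbrev H2 : Type _ := Z2 G q ⧸ (B2 G q).addSubgroupOf (Z2 G q)

variable {G q}

/-- The class of a 2-cocycle. -/
abbrev H2.mk : Z2 G q →+ H2 G q := QuotientAddGroup.mk' ((B2 G q).addSubgroupOf (Z2 G q))

/-- The cocycle `(σ, τ) ↦ ψ(σ) ψ'(τ)` that represents the cup product of `ψ` and `ψ'`. -/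
def cupCocycle (ψ ψ' : H1 G q) : Z2 G q :=
  ⟨⟨fun x => ψ (Additive.ofMul x.1) * ψ' (Additive.ofMul x.2),
    ((map_continuous ψ).comp (continuous_ofMul.comp continuous_fst)).mul
      ((map_continuous ψ').comp (continuous_ofMul.comp continuous_snd))⟩, by
    rw [AddMonoidHom.mem_ker]
    ext x
    simp [d2]
    ring⟩

/-- The cup product `H¹(G) × H¹(G) → H²(G)`, as a biadditive map. -/
def cup : H1 G q →+ H1 G q →+ H2 G q :=
  AddMonoidHom.mk' (fun ψ => AddMonoidHom.mk' (fun ψ' => H2.mk (cupCocycle ψ ψ')) (by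
      intro a b
      rw [← map_add]
      congr 1
      refine Subtype.ext (ContinuousMap.ext fun x => ?_)
      simp [cupCocycle, mul_add])) (by
    intro a b
    ext ψ'
    change H2.mk (cupCocycle (a + b) ψ') = H2.mk (cupCocycle a ψ') + H2.mk (cupCocycle b ψ')
    rw [← map_add]
    congr 1
    refine Subtype.ext (ContinuousMap.ext fun x => ?_)
    simp [cupCocycle, add_mul])

variable (G q) in
/-- The homomorphism `H¹(G) ⊗_ℤ H¹(G) → H²(G)` with `ψ ⊗ ψ' ↦ ψ ∪ ψ'`. -/
noncomputable def cupHom : H1 G q ⊗[ℤ] H1 G q →+ H2 G q :=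
  TensorProduct.liftAddHom (cup (G := G) (q := q)) (by simp)

theorem cupHom_tmul (ψ ψ' : H1 G q) : cupHom G q (ψ ⊗ₜ[ℤ] ψ') = cup ψ ψ' := rfl

section Bockstein

variable [NeZero q]

theorem carry_eq (a b : ZMod q) :
    (q : ℤ) * (((a.val + b.val) / q : ℕ) : ℤ) = a.val + b.val - (a + b).val := by
  rw [ZMod.val_add]
  have := Nat.div_add_mod (a.val + b.val) q
  zify at this
  push_cast
  linarith

/-- The cocycle representing the Bockstein of `ψ`. Lift `ψ` to `ℤ/q²` by taking representatives
`0 ≤ ψ(σ) < q`; then `ψ(σ) + ψ(τ) - ψ(στ)` is `q` times the carry `⌊(ψ(σ) + ψ(τ)) / q⌋`, i.e. it is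
the image of that carry under the injection `ℤ/q → ℤ/q²`, `1 ↦ q`. -/
def bocksteinCocycle (ψ : H1 G q) : Z2 G q :=
  ⟨⟨fun x => (((ψ (Additive.ofMul x.1)).val + (ψ (Additive.ofMul x.2)).val) / q : ℕ),
    (continuous_of_discreteTopology (f := fun y : ZMod q × ZMod q =>
      (((y.1.val + y.2.val) / q : ℕ) : ZMod q))).comp
      (((map_continuous ψ).comp (continuous_ofMul.comp continuous_fst)).prodMk
        ((map_continuous ψ).comp (continuous_ofMul.comp continuous_snd)))⟩, by
    rw [AddMonoidHom.mem_ker]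
    ext ⟨σ, τ, ρ⟩
    have hq : (q : ℤ) ≠ 0 := by exact_mod_cast NeZero.ne q
    set a := ψ (Additive.ofMul σ) with ha
    set b := ψ (Additive.ofMul τ) with hb
    set c := ψ (Additive.ofMul ρ) with hc
    have key : (((b.val + c.val) / q : ℕ) : ℤ) - (((a + b).val + c.val) / q : ℕ)
        + ((a.val + (b + c).val) / q : ℕ) - ((a.val + b.val) / q : ℕ) = 0 := by
      apply mul_left_cancel₀ hq
      rw [mul_sub, mul_add, mul_sub, carry_eq, carry_eq, carry_eq, carry_eq, add_assoc]
      ring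
    have := congrArg (Int.cast : ℤ → ZMod q) key
    simp only [Int.cast_add, Int.cast_sub, Int.cast_natCast, Int.cast_zero] at this
    simpa [d2, ofMul_mul, ← ha, ← hb, ← hc] using this⟩

/-- The Bockstein map `β : H¹(G, ℤ/q) → H²(G, ℤ/q)`, the connecting map of
`0 → ℤ/q → ℤ/q² → ℤ/q → 0` (see `bockstein_eq`). -/
def bockstein (ψ : H1 G q) : H2 G q := H2.mk (bocksteinCocycle ψ)

/-- `bockstein` is the connecting map: if `ψ'` is any continuous lift of `ψ` to a `ℤ/q²`-valued
1-cochain, and `c` is a 2-cochain whose image under `ℤ/q → ℤ/q²`, `1 ↦ q`, is the coboundary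
of `ψ'`, then the class of `c` is `bockstein ψ`. -/
theorem bockstein_eq (ψ : H1 G q) (ψ' : C(G, ZMod (q * q))) (c : C(G × G, ZMod q))
    (hψ' : ∀ σ, ZMod.castHom (dvd_mul_left q q) (ZMod q) (ψ' σ) = ψ (Additive.ofMul σ))
    (hc : ∀ σ τ, (q : ZMod (q * q)) * (c (σ, τ)).val = ψ' τ - ψ' (σ * τ) + ψ' σ) :
    ∃ h : c ∈ Z2 G q, H2.mk ⟨c, h⟩ = bockstein ψ := by
  have hq : (q : ℤ) ≠ 0 := by exact_mod_cast NeZero.ne q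
  let b : C(G, ZMod q) := ⟨fun σ => (((ψ' σ).val / q : ℕ) : ZMod q),
    (continuous_of_discreteTopology (f := fun y : ZMod (q * q) =>
      ((y.val / q : ℕ) : ZMod q))).comp ψ'.continuous⟩
  have hb : ∀ σ, ((ψ' σ).val : ℤ) = (ψ (Additive.ofMul σ)).val + q * ((ψ' σ).val / q : ℕ) := by
    intro σ
    have h1 : (ψ (Additive.ofMul σ)).val = (ψ' σ).val % q := by
      rw [← hψ' σ, ZMod.castHom_apply, ZMod.cast_eq_val, ZMod.val_natCast]
    have := Nat.div_add_mod (ψ' σ).val q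
    rw [h1]
    zify at this
    push_cast
    linarith
  have hd : c = (bocksteinCocycle ψ : C(G × G, ZMod q)) + d1 G q b := by
    ext ⟨σ, τ⟩
    have h1 := hc σ τ
    have h2 : (((q : ℤ) * (c (σ, τ)).val : ℤ) : ZMod (q * q))
        = (((ψ' τ).val - (ψ' (σ * τ)).val + (ψ' σ).val : ℤ) : ZMod (q * q)) := by
      push_cast
      simpa using h1
    rw [hb, hb, hb, ofMul_mul, map_add] at h2
    have h3 := carry_eq (ψ (Additive.ofMul σ)) (ψ (Additive.ofMul τ))
    rw [ZMod.intCast_eq_intCast_iff_dvd_sub] at h2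
    obtain ⟨k, hk⟩ := h2
    have h4 : ((((ψ (Additive.ofMul σ)).val + (ψ (Additive.ofMul τ)).val) / q : ℕ) : ℤ)
        + ((((ψ' τ).val / q : ℕ) : ℤ) - ((ψ' (σ * τ)).val / q : ℕ) + ((ψ' σ).val / q : ℕ))
        - (c (σ, τ)).val = q * k := by
      apply mul_left_cancel₀ hq
      push_cast at hk h3 ⊢
      linear_combination hk + h3
    have h5 := congrArg (Int.cast : ℤ → ZMod q) h4
    simp only [Int.cast_add, Int.cast_sub, Int.cast_mul, Int.cast_natCast] at h5
    rw [ZMod.natCast_self, zero_mul, sub_eq_zero, ZMod.natCast_zmod_val] at h5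
    simpa [bocksteinCocycle, d1, b] using h5.symm
  have hmem : c ∈ Z2 G q := by
    rw [hd]
    exact add_mem (bocksteinCocycle ψ).2 (B2_le_Z2 G q ⟨b, rfl⟩)
  refine ⟨hmem, ?_⟩
  rw [bockstein, QuotientAddGroup.mk'_apply, QuotientAddGroup.mk'_apply, eq_comm,
    QuotientAddGroup.eq, AddSubgroup.mem_addSubgroupOf]
  refine ⟨b, ?_⟩
  simp [hd]

end Bockstein

/-- The natural map `H¹(G, ℤ/q) → H¹(G, ℤ/m)` for `m ∣ q`. -/
def H1.reduce {m : ℕ} (hm : m ∣ q) (ψ : H1 G q) : H1 G m :=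
  ContinuousAddMonoidHom.comp
    ⟨(ZMod.castHom hm (ZMod m)).toAddMonoidHom, continuous_of_discreteTopology⟩ ψ

variable (G q) in
/-- Groups of Galois relation type with respect to `q` (a power of a prime `p`; the divisors of `q`
are then `1` and the powers `pⁱ` with `1 ≤ i ≤ d`, `q = pᵈ`, and for `m = 1` the last condition
holds trivially). -/
structure IsGaloisRelationType [NeZero q] : Prop where
  /-- The kernel of the cup product on `H¹ ⊗ H¹` is generated by the pure tensors that it
  contains. -/
  ker_cup : (cupHom G q).ker = AddSubgroup.closure
    {x | x ∈ (cupHom G q).ker ∧ ∃ ψ ψ' : H1 G q, x = ψ ⊗ₜ[ℤ] ψ'}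
  /-- There is a class `ξ` with `ψ ∪ ξ + β(ψ) = 0` for all `ψ`. -/
  bockstein_cup : ∃ ξ : H1 G q, ∀ ψ : H1 G q, cup ψ ξ + bockstein ψ = 0
  /-- `H¹(G, ℤ/q) → H¹(G, ℤ/m)` is surjective. -/
  reduce_surjective : ∀ (m : ℕ) (hm : m ∣ q), Function.Surjective (H1.reduce (G := G) hm)

end Cohomology

section CentralSequence

variable (G : Type*) [Group G] [TopologicalSpace G] [IsTopologicalGroup G]

/-- The closed subgroup `N^q [N, G]` generated by all `h^q` and all `h⁻¹ g⁻¹ h g` with `h ∈ N`,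
`g ∈ G`. -/
def centralStep (q : ℕ) (N : Subgroup G) : Subgroup G :=
  (Subgroup.closure ({x | ∃ h ∈ N, x = h ^ q} ∪
    {x | ∃ h ∈ N, ∃ g : G, x = h⁻¹ * g⁻¹ * h * g})).topologicalClosure

/-- The descending `q`-central sequence `G^{(i)}`, `i = 1, 2, …`, with `G^{(1)} = G` and
`G^{(i+1)} = (G^{(i)})^q [G^{(i)}, G]`. The index `0` is not used and has the value `G`. -/
def descendingCentral (q : ℕ) : ℕ → Subgroup G
  | 0 => ⊤
  | 1 => ⊤
  | i + 2 => centralStep G q (descendingCentral q (i + 1))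

theorem centralStep_normal (q : ℕ) (N : Subgroup G) [hN : N.Normal] :
    (centralStep G q N).Normal := by
  have : (Subgroup.closure ({x | ∃ h ∈ N, x = h ^ q} ∪
      {x | ∃ h ∈ N, ∃ g : G, x = h⁻¹ * g⁻¹ * h * g})).Normal := by
    refine ⟨fun n hn g => ?_⟩
    induction hn using Subgroup.closure_induction with
    | mem x hx =>
      apply Subgroup.subset_closure
      rcases hx with ⟨h, hh, rfl⟩ | ⟨h, hh, k, rfl⟩
      · exact Or.inl ⟨g * h * g⁻¹, hN.conj_mem h hh g, by simp⟩
      · exact Or.inr ⟨g * h * g⁻¹, hN.conj_mem h hh g, g * k * g⁻¹, by group⟩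
    | one => simp
    | mul x y _ _ hx hy => simpa using mul_mem hx hy
    | inv x _ hx => simpa [mul_assoc] using inv_mem hx
  exact Subgroup.is_normal_topologicalClosure _

instance descendingCentral_normal (q : ℕ) : ∀ i, (descendingCentral G q i).Normal
  | 0 => inferInstanceAs (⊤ : Subgroup G).Normal
  | 1 => inferInstanceAs (⊤ : Subgroup G).Normal
  | i + 2 =>
    have := descendingCentral_normal q (i + 1)
    centralStep_normal G q (descendingCentral G q (i + 1))

end CentralSequence

end GaloisRelation

namespace GaloisRelation

variable {G : Type*} [Group G] [TopologicalSpace G] [IsTopologicalGroup G]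

/-! The relation `ψ ∪ ξ + β(ψ) = 0` yields a continuous cochain `b : G → ℤ/p` whose coboundary is
the explicit cocycle `ψ(σ)ξ(τ) + carry(ψ(σ), ψ(τ))`. On `G^{(2)}` this cocycle is trivial and `b` is
a conjugation-invariant homomorphism into a group of exponent `p`, hence `b` vanishes on `G^{(3)}`
(`cochain_eq_zero_of_mem_descendingCentral_three`). Summing the coboundary along powers of `σ`
(`cochain_pow`) gives `b(σ^p) = -ψ(σ)` for odd `p`. So `σ^p ∈ G^{(3)}` forces `ψ(σ) = 0` for every
`ψ`, and characters to `ℤ/p` separate points modulo `G^{(2)}`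
(`mem_descendingCentral_two_of_forall_H1`). -/

theorem centralStep_le {q : ℕ} {N L : Subgroup G} (hL : IsClosed (L : Set G))
    (hpow : ∀ h ∈ N, h ^ q ∈ L) (hcomm : ∀ h ∈ N, ∀ g : G, h⁻¹ * g⁻¹ * h * g ∈ L) :
    centralStep G q N ≤ L := by
  refine Subgroup.topologicalClosure_minimal _ ((Subgroup.closure_le _).2 ?_) hL
  rintro _ (⟨h, hh, rfl⟩ | ⟨h, hh, g, rfl⟩)
  · exact hpow h hh
  · exact hcomm h hh g

theorem pow_mem_centralStep {q : ℕ} {N : Subgroup G} {h : G} (hh : h ∈ N) :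
    h ^ q ∈ centralStep G q N :=
  Subgroup.le_topologicalClosure _ (Subgroup.subset_closure (Or.inl ⟨h, hh, rfl⟩))

theorem commutator_mem_centralStep {q : ℕ} {N : Subgroup G} {h : G} (hh : h ∈ N) (g : G) :
    h⁻¹ * g⁻¹ * h * g ∈ centralStep G q N :=
  Subgroup.le_topologicalClosure _ (Subgroup.subset_closure (Or.inr ⟨h, hh, g, rfl⟩))

/-- The kernel of a class in `H¹(G, ℤ/q)`, as a subgroup of `G`. -/
def H1.ker {q : ℕ} (ψ : H1 G q) : Subgroup G where
  carrier := {g | ψ (Additive.ofMul g) = 0}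
  mul_mem' {a b} ha hb := by
    simp only [Set.mem_ofPred_eq] at ha hb ⊢
    rw [ofMul_mul, map_add, ha, hb, add_zero]
  one_mem' := by simp
  inv_mem' {a} ha := by
    simp only [Set.mem_ofPred_eq] at ha ⊢
    rw [ofMul_inv, map_neg, ha, neg_zero]

omit [IsTopologicalGroup G] in
theorem H1.mem_ker {q : ℕ} {ψ : H1 G q} {g : G} : g ∈ ψ.ker ↔ ψ (Additive.ofMul g) = 0 :=
  Iff.rfl

omit [IsTopologicalGroup G] in
theorem H1.isClosed_ker {q : ℕ} (ψ : H1 G q) : IsClosed (ψ.ker : Set G) :=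
  isClosed_singleton.preimage ((map_continuous ψ).comp continuous_ofMul)

theorem descendingCentral_two_le_ker {q : ℕ} (ψ : H1 G q) : descendingCentral G q 2 ≤ ψ.ker := by
  refine centralStep_le ψ.isClosed_ker (fun h _ => ?_) (fun h _ g => ?_)
  · rw [H1.mem_ker, ofMul_pow, map_nsmul, nsmul_eq_mul, ZMod.natCast_self, zero_mul]
  · rw [H1.mem_ker]
    simp only [ofMul_mul, ofMul_inv, map_add, map_neg]
    ring

/-- If the class of `ψ ∪ ξ + β(ψ)` vanishes, its cocycle is the coboundary of some `b`. -/
theorem exists_cochain_of_cup_add_bockstein_eq_zero {q : ℕ} [NeZero q] {ψ ξ : H1 G q}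
    (h : cup ψ ξ + bockstein ψ = 0) :
    ∃ b : C(G, ZMod q), ∀ σ τ : G, b τ - b (σ * τ) + b σ =
      ψ (Additive.ofMul σ) * ξ (Additive.ofMul τ) +
        (((ψ (Additive.ofMul σ)).val + (ψ (Additive.ofMul τ)).val) / q : ℕ) := by
  change H2.mk (cupCocycle ψ ξ) + H2.mk (bocksteinCocycle ψ) = 0 at h
  rw [← map_add, QuotientAddGroup.mk'_apply, QuotientAddGroup.eq_zero_iff,
    AddSubgroup.mem_addSubgroupOf] at h
  obtain ⟨b, hb⟩ := h
  exact ⟨b, fun σ τ => DFunLike.congr_fun hb (σ, τ)⟩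

/-! ### Cochains trivializing `ψ ∪ ξ + β(ψ)`. -/

section Cochain

variable {q : ℕ} [NeZero q] {ψ ξ : H1 G q} {b : C(G, ZMod q)}
  (hb : ∀ σ τ : G, b τ - b (σ * τ) + b σ =
      ψ (Additive.ofMul σ) * ξ (Additive.ofMul τ) +
        (((ψ (Additive.ofMul σ)).val + (ψ (Additive.ofMul τ)).val) / q : ℕ))

include hb

omit [IsTopologicalGroup G] in
-- When `ψ(k) = 0`, both the product and the carry vanish; `ξ` plays no role on this side.
theorem cochain_mul_of_mem_ker_left {k : G} (hψ : k ∈ ψ.ker) (g : G) :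
    b (k * g) = b k + b g := by
  have h := hb k g
  rw [H1.mem_ker.1 hψ, zero_mul, ZMod.val_zero, zero_add, zero_add,
    Nat.div_eq_of_lt (ZMod.val_lt _), Nat.cast_zero] at h
  linear_combination -h

omit [IsTopologicalGroup G] in
-- Here `ψ(k) = 0` only removes the carry; removing the product `ψ(g)ξ(k)` takes `ξ(k) = 0`.
theorem cochain_mul_of_mem_ker_right {k : G} (hψ : k ∈ ψ.ker) (hξ : k ∈ ξ.ker) (g : G) :
    b (g * k) = b g + b k := by
  have h := hb g k
  rw [H1.mem_ker.1 hψ, H1.mem_ker.1 hξ, mul_zero, ZMod.val_zero, add_zero, zero_add,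
    Nat.div_eq_of_lt (ZMod.val_lt _), Nat.cast_zero] at h
  linear_combination -h

omit [IsTopologicalGroup G] in
theorem cochain_one : b 1 = 0 := by
  have h := cochain_mul_of_mem_ker_left hb (one_mem _) 1
  rw [mul_one] at h
  linear_combination -h

omit [IsTopologicalGroup G] in
theorem cochain_inv_of_mem_ker {k : G} (hψ : k ∈ ψ.ker) : b k⁻¹ = -b k := by
  have h := cochain_mul_of_mem_ker_left hb hψ k⁻¹
  rw [mul_inv_cancel, cochain_one hb] at h
  linear_combination -h

omit [IsTopologicalGroup G] in
theorem cochain_pow_of_mem_ker {k : G} (hψ : k ∈ ψ.ker) (n : ℕ) : b (k ^ n) = n * b k := by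
  induction n with
  | zero => simp [cochain_one hb]
  | succ n ih =>
    rw [pow_succ', cochain_mul_of_mem_ker_left hb hψ, ih]
    push_cast
    ring

theorem cochain_eq_zero_of_mem_descendingCentral_three {g : G}
    (hg : g ∈ descendingCentral G q 3) : b g = 0 := by
  let L : Subgroup G :=
    { carrier := {g | g ∈ ψ.ker ∧ b g = 0}
      mul_mem' := fun {x y} hx hy =>
        ⟨mul_mem hx.1 hy.1, by rw [cochain_mul_of_mem_ker_left hb hx.1, hx.2, hy.2, add_zero]⟩
      one_mem' := ⟨one_mem _, cochain_one hb⟩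
      inv_mem' := fun {x} hx =>
        ⟨inv_mem hx.1, by rw [cochain_inv_of_mem_ker hb hx.1, hx.2, neg_zero]⟩ }
  have hL : IsClosed (L : Set G) :=
    ψ.isClosed_ker.inter (isClosed_singleton.preimage b.continuous)
  refine (centralStep_le (L := L) hL (fun h hh => ?_) (fun h hh g => ?_) hg).2
  · have hψ := descendingCentral_two_le_ker ψ hh
    refine ⟨pow_mem hψ q, ?_⟩
    rw [cochain_pow_of_mem_ker hb hψ, ZMod.natCast_self, zero_mul]
  · have hψ := descendingCentral_two_le_ker ψ hh
    have hc : g⁻¹ * h * g ∈ descendingCentral G q 2 := by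
      simpa using (descendingCentral_normal G q 2).conj_mem h hh g⁻¹
    have hcψ := descendingCentral_two_le_ker ψ hc
    have hcξ := descendingCentral_two_le_ker ξ hc
    -- Conjugation invariance: with `k = g⁻¹hg`, expanding `b(gk) = b(hg)` on both sides gives `b(k)
    -- = b(h)`.
    have h1 := cochain_mul_of_mem_ker_right hb hcψ hcξ g
    rw [show g * (g⁻¹ * h * g) = h * g by group, cochain_mul_of_mem_ker_left hb hψ] at h1
    have h2 := cochain_mul_of_mem_ker_left hb (inv_mem hψ) (g⁻¹ * h * g)
    rw [cochain_inv_of_mem_ker hb hψ] at h2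
    rw [show h⁻¹ * g⁻¹ * h * g = h⁻¹ * (g⁻¹ * h * g) by group]
    exact ⟨mul_mem (inv_mem hψ) hcψ, by linear_combination h2 - h1⟩

omit [IsTopologicalGroup G] in
-- Sum the coboundary relation at `(σ^i, σ)` for `i < n`: the products contribute `0 + 1 + ⋯ +
-- (n-1)` copies of `ψ(σ)ξ(σ)`, and the carries of repeatedly adding `ψ(σ)` modulo `q` total the
-- integer quotient.
theorem cochain_pow (σ : G) (n : ℕ) :
    b (σ ^ n) = n * b σ - n.choose 2 * (ψ (Additive.ofMul σ) * ξ (Additive.ofMul σ))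
      - (n * (ψ (Additive.ofMul σ)).val / q : ℕ) := by
  induction n with
  | zero => simp [cochain_one hb]
  | succ n ih =>
    have h := hb (σ ^ n) σ
    set s := ψ (Additive.ofMul σ) with hs
    have hval : (ψ (Additive.ofMul (σ ^ n))).val = n * s.val % q := by
      rw [ofMul_pow, map_nsmul, ← hs, nsmul_eq_mul, ZMod.val_mul, ZMod.val_natCast,
        Nat.mod_mul_mod]
    have hcarry : (n + 1) * s.val / q = n * s.val / q + (n * s.val % q + s.val) / q := by
      have hdiv : (n + 1) * s.val = (n * s.val % q + s.val) + q * (n * s.val / q) := by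
        rw [add_right_comm, Nat.mod_add_div]
        ring
      rw [hdiv, Nat.add_mul_div_left _ _ (NeZero.pos q), add_comm]
    rw [hval, ofMul_pow, map_nsmul, nsmul_eq_mul, ih, ← pow_succ, ← hs] at h
    rw [hcarry, Nat.choose_succ_succ' n 1, Nat.choose_one_right]
    push_cast
    linear_combination -h

end Cochain

/-- For odd `q` and `ψ ∪ ξ + β(ψ) = 0`, the class `ψ` vanishes on every `σ` with
`σ ^ q ∈ G^{(3)}`. -/
theorem H1.eq_zero_of_pow_mem_descendingCentral_three {q : ℕ} [NeZero q] (hq : Odd q)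
    {ψ ξ : H1 G q} (h : cup ψ ξ + bockstein ψ = 0) {σ : G}
    (hσ : σ ^ q ∈ descendingCentral G q 3) : ψ (Additive.ofMul σ) = 0 := by
  obtain ⟨b, hb⟩ := exists_cochain_of_cup_add_bockstein_eq_zero h
  have h1 := cochain_pow hb σ q
  -- Oddness enters here: `(q-1)/2` is an integer, so `q` divides `q(q-1)/2`.
  have hchoose : ((q.choose 2 : ℕ) : ZMod q) = 0 := by
    rw [ZMod.natCast_eq_zero_iff, Nat.choose_two_right,
      Nat.mul_div_assoc _ (Nat.Odd.sub_odd hq odd_one).two_dvd]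
    exact dvd_mul_right _ _
  -- Only the carry term survives, and at `n = q` it is `ψ(σ)` itself.
  rw [cochain_eq_zero_of_mem_descendingCentral_three hb hσ, hchoose, ZMod.natCast_self,
    Nat.mul_div_cancel_left _ (NeZero.pos q), ZMod.natCast_zmod_val] at h1
  linear_combination h1

/-! ### Separating points modulo `G^{(2)}` by characters. -/

/-- A class in `H¹(G, ℤ/q)` from a homomorphism on the quotient by an open normal subgroup. -/
def H1.ofQuotient {q : ℕ} (U : Subgroup G) [U.Normal] (hU : IsOpen (U : Set G))
    (f : Additive (G ⧸ U) →+ ZMod q) : H1 G q where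
  toAddMonoidHom := f.comp (QuotientGroup.mk' U).toAdditive
  continuous_toFun := by
    have := QuotientGroup.discreteTopology hU
    exact (continuous_of_discreteTopology (f := fun y : G ⧸ U => f (Additive.ofMul y))).comp
      (continuous_quotient_mk'.comp continuous_toMul)

/-- Homomorphisms to `ℤ/p` separate the elements of an abelian group of exponent `p`. -/
theorem exists_addMonoidHom_zmod_ne_zero {p : ℕ} [Fact p.Prime] {A : Type*} [AddCommGroup A]
    (hp : ∀ a : A, p • a = 0) {a : A} (ha : a ≠ 0) : ∃ f : A →+ ZMod p, f a ≠ 0 := by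
  have dual_ne_zero [Module (ZMod p) A] : ∃ f : Module.Dual (ZMod p) A, f a ≠ 0 :=
    Module.Projective.exists_dual_ne_zero (ZMod p) ha
  obtain ⟨f, hf⟩ := @dual_ne_zero (AddCommGroup.zmodModule hp)
  exact ⟨@LinearMap.toAddMonoidHom _ _ _ _ _ _ _ _ (AddCommGroup.zmodModule hp) _ _ f, hf⟩

/-- In a profinite group, `H¹(G, ℤ/p)` detects the elements outside `G^{(2)}`. -/
theorem mem_descendingCentral_two_of_forall_H1 [CompactSpace G] [TotallyDisconnectedSpace G]
    {p : ℕ} [Fact p.Prime] {σ : G} (h : ∀ ψ : H1 G p, ψ (Additive.ofMul σ) = 0) :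
    σ ∈ descendingCentral G p 2 := by
  by_contra hσ
  let N : Subgroup G := descendingCentral G p 2
  have hN : IsClosed (N : Set G) := Subgroup.isClosed_topologicalClosure _
  -- An open normal `V` with `σV` disjoint from `N` keeps `σ` out of `U = NV`. As `U` is open, every
  -- homomorphism on `G/U` is continuous; as `U` contains `N`, the quotient is abelian of exponent
  -- `p`.
  have hopen : IsOpen ((fun g => σ * g) ⁻¹' (N : Set G)ᶜ) :=
    hN.isOpen_compl.preimage (continuous_const_mul σ)
  obtain ⟨V, hV⟩ := ProfiniteGrp.exist_openNormalSubgroup_sub_open_nhds_of_one hopen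
    (by simpa [N] using hσ)
  let U : Subgroup G := N ⊔ V.toSubgroup
  have hU : IsOpen (U : Set G) := Subgroup.isOpen_mono le_sup_right V.isOpen'
  have hσU : σ ∉ U := by
    intro hmem
    obtain ⟨n, hn, v, hv, rfl⟩ := Subgroup.mem_sup_of_normal_right.1 hmem
    exact hV (inv_mem hv) (by simpa using hn)
  have hcomm : ∀ a c : G ⧸ U, a * c = c * a := by
    intro a c
    induction a using QuotientGroup.induction_on with | H a => ?_
    induction c using QuotientGroup.induction_on with | H c => ?_
    rw [← QuotientGroup.mk_mul, ← QuotientGroup.mk_mul, eq_comm, QuotientGroup.eq]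
    refine le_sup_left (a := N) ?_
    have := commutator_mem_centralStep (q := p) (N := descendingCentral G p 1) (h := a)
      (Subgroup.mem_top a) c
    have heq : a⁻¹ * c⁻¹ * a * c = (c * a)⁻¹ * (a * c) := by group
    exact heq ▸ this
  let _ : AddCommGroup (Additive (G ⧸ U)) :=
    { (inferInstance : AddGroup (Additive (G ⧸ U))) with
      add_comm := fun a c => hcomm a.toMul c.toMul }
  have hpow : ∀ a : Additive (G ⧸ U), p • a = 0 := by
    intro a
    induction a using Additive.rec with | ofMul a => ?_
    induction a using QuotientGroup.induction_on with | H a => ?_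
    rw [← ofMul_pow, ← QuotientGroup.mk_pow, ofMul_eq_zero, QuotientGroup.eq_one_iff]
    exact le_sup_left (a := N)
      (pow_mem_centralStep (N := descendingCentral G p 1) (Subgroup.mem_top a))
  have hne : Additive.ofMul (σ : G ⧸ U) ≠ 0 := by
    rwa [Ne, ofMul_eq_zero, QuotientGroup.eq_one_iff]
  obtain ⟨f, hf⟩ := exists_addMonoidHom_zmod_ne_zero hpow hne
  exact hf (h (H1.ofQuotient U hU f))

end GaloisRelation

theorem proposition12p3 (p : ℕ) [Fact p.Prime] (hp : p ≠ 2)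
    (G : Type*) [Group G] [TopologicalSpace G] [IsTopologicalGroup G]
    [CompactSpace G] [TotallyDisconnectedSpace G]
    (hG : GaloisRelation.IsGaloisRelationType G p)
    (x : G ⧸ GaloisRelation.descendingCentral G p 3) (hx : orderOf x = p) :
    x ∈
      (GaloisRelation.descendingCentral G p 2).map
        (QuotientGroup.mk' (GaloisRelation.descendingCentral G p 3)) := by
  induction x using QuotientGroup.induction_on with | H σ => ?_
  obtain ⟨ξ, hξ⟩ := hG.bockstein_cup
  have hσ : σ ^ p ∈ GaloisRelation.descendingCentral G p 3 := by
    rw [← QuotientGroup.eq_one_iff, QuotientGroup.mk_pow]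
    exact orderOf_dvd_iff_pow_eq_one.1 hx.dvd
  have hp' : Odd p := (Fact.out : p.Prime).odd_of_ne_two hp
  exact ⟨σ, GaloisRelation.mem_descendingCentral_two_of_forall_H1 fun ψ =>
    GaloisRelation.H1.eq_zero_of_pow_mem_descendingCentral_three hp' (hξ ψ) hσ, rfl⟩
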